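/- Let $\mathcal{P}_2(\mathbb{R}^d)$ be the set of Borel probability measures $\mu$ on $\mathbb{R}^d$ with $\int \|x\|^2\,d\mu(x) < \infty$, where $\|\cdot\|$ is the Euclidean norm, and equip it with the 2-Wasserstein distance $$\mathcal{W}_2(\mu,\nu) = \Bigl(\inf_{\pi \in \Pi(\mu,\nu)} \int_{\mathbb{R}^d\times\mathbb{R}^d} \|x-y\|^2\,d\pi(x,y)\Bigr)^{1/2},$$ where $\Pi(\mu,\nu)$ is the set of probability measures on $\mathbb{R}^d\times\mathbb{R}^d$ with marginals $\mu$ and $\nu$. Let $\Lambda$ be a random element of $\mathcal{P}_2(\mathbb{R}^d)$, that is, a measurable map from a probability space to $\mathcal{P}_2(\mathbb{R}^d)$ with the Borel $\sigma$-algebra of the $\mathcal{W}_2$-topology. Then the functional $$F : \mathcal{P}_2(\mathbb{R}^d) \to [0,\infty], \qquad F(\nu) = \mathbb{E}\,\mathcal{W}_2(\nu,\Lambda),$$ admits a minimizer: there is $\nu^* \in \mathcal{P}_2(\mathbb{R}^d)$ with $F(\nu^*) \le F(\nu)$ for all $\nu \in \mathcal{P}_2(\mathbb{R}^d)$. (If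 $F$ is identically $+\infty$, every $\nu$ is a minimizer.) Such a $\nu^*$ is called a Wasserstein median of $\Lambda$. -/

import Mathlib

open MeasureTheory
open scoped ENNReal

noncomputable section

/-- The space `𝒫₂(ℝᵈ)` of Borel probability measures on `ℝᵈ` (with the Euclidean norm) that have a
finite second moment. It is a structure, so that it does not silently inherit the weak topology. -/
structure P2 (d : ℕ) where
  /-- the underlying probability measure -/
  prob : ProbabilityMeasure (EuclideanSpace ℝ (Fin d))
  /-- the second moment is finite -/
  second_moment_lt_top :
    ∫⁻ x, ‖x‖ₑ ^ 2 ∂(prob : Measure (EuclideanSpace ℝ (Fin d))) < ∞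

/-- The set `Π(μ, ν)` of couplings: joint probability measures on `ℝᵈ × ℝᵈ` whose first and second
marginals are `μ` and `ν`. -/
def couplings {d : ℕ} (μ ν : P2 d) :
    Set (ProbabilityMeasure (EuclideanSpace ℝ (Fin d) × EuclideanSpace ℝ (Fin d))) :=
  {π | (π : Measure (EuclideanSpace ℝ (Fin d) × EuclideanSpace ℝ (Fin d))).map Prod.fst = μ.prob ∧
    (π : Measure (EuclideanSpace ℝ (Fin d) × EuclideanSpace ℝ (Fin d))).map Prod.snd = ν.prob}

/-- The 2-Wasserstein distance
`𝒲₂(μ, ν) = (inf_{π ∈ Π(μ, ν)} ∫ ‖x - y‖² dπ(x, y)) ^ (1/2)` (Kantorovich formulation), as an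
extended nonnegative real number. -/
def W2 {d : ℕ} (μ ν : P2 d) : ℝ≥0∞ :=
  (⨅ π ∈ couplings μ ν, ∫⁻ z, ‖z.1 - z.2‖ₑ ^ 2
    ∂(π : Measure (EuclideanSpace ℝ (Fin d) × EuclideanSpace ℝ (Fin d)))) ^ (1 / 2 : ℝ)

/-- The topology of the metric `𝒲₂` on `𝒫₂(ℝᵈ)`: the one generated by the open `𝒲₂`-balls. -/
instance P2.instTopologicalSpace (d : ℕ) : TopologicalSpace (P2 d) :=
  TopologicalSpace.generateFrom {B | ∃ (μ : P2 d) (r : ℝ≥0∞), B = {ν | W2 μ ν < r}}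

/-- `𝒫₂(ℝᵈ)` carries the Borel `σ`-algebra of the `𝒲₂`-topology. -/
instance P2.instMeasurableSpace (d : ℕ) : MeasurableSpace (P2 d) := borel (P2 d)

instance P2.instBorelSpace (d : ℕ) : BorelSpace (P2 d) := ⟨rfl⟩

/-- The Fréchet functional `F(ν) = 𝔼 𝒲₂(ν, Λ)` of a random element `Λ` of `𝒫₂(ℝᵈ)`, defined on a
probability space `(Ω, P)`; its values lie in `[0, ∞]`. -/
def frechetFunctional {d : ℕ} {Ω : Type*} [MeasurableSpace Ω] (P : Measure Ω) (Λ : Ω → P2 d)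
    (ν : P2 d) : ℝ≥0∞ :=
  ∫⁻ ω, W2 ν (Λ ω) ∂P

/-- `ν` is a Wasserstein median of `Λ`: a minimizer over `𝒫₂(ℝᵈ)` of the Fréchet functional. -/
def IsWassersteinMedian {d : ℕ} {Ω : Type*} [MeasurableSpace Ω] (P : Measure Ω) (Λ : Ω → P2 d)
    (ν : P2 d) : Prop :=
  ∀ ξ : P2 d, frechetFunctional P Λ ν ≤ frechetFunctional P Λ ξ

end

open Filter Topology

/-! Direct method for the weak topology. Since `Λ` lies in a fixed second-moment ball with
probability above 1/2, Markov's inequality bounds the second moments on any finite sublevel set of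
`F`. A minimizing sequence is therefore tight, and Prokhorov's theorem gives a weak limit, whose
second moment is finite by lower semicontinuity. `W2_le_liminf_of_tendsto` and Fatou's lemma then
show that `F` at the limit is at most the infimum. -/

/-- Weak convergence makes the integral of a nonnegative continuous function lower
semicontinuous. -/
theorem lintegral_le_liminf_of_tendsto_probabilityMeasure {X : Type*} [TopologicalSpace X]
    [MeasurableSpace X] [OpensMeasurableSpace X] [HasOuterApproxClosed X]
    {μ : ProbabilityMeasure X} {μs : ℕ → ProbabilityMeasure X} (h : Tendsto μs atTop (𝓝 μ))
    {f : X → ℝ} (hf : Continuous f) (hf0 : 0 ≤ f) :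
    ∫⁻ x, ENNReal.ofReal (f x) ∂(μ : Measure X) ≤
      atTop.liminf fun n ↦ ∫⁻ x, ENNReal.ofReal (f x) ∂(μs n : Measure X) :=
  lintegral_le_liminf_lintegral_of_forall_isOpen_measure_le_liminf_measure hf hf0
    fun _ hG ↦ ProbabilityMeasure.le_liminf_measure_open_of_tendsto h hG

theorem enorm_sq_eq_ofReal {E : Type*} [SeminormedAddCommGroup E] (x : E) :
    ‖x‖ₑ ^ 2 = ENNReal.ofReal (‖x‖ ^ 2) := by
  rw [ENNReal.ofReal_pow (norm_nonneg x), ofReal_norm]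

theorem enorm_add_sq_le {E : Type*} [SeminormedAddCommGroup E] (x y : E) :
    ‖x + y‖ₑ ^ 2 ≤ 2 * (‖x‖ₑ ^ 2 + ‖y‖ₑ ^ 2) := by
  simp only [enorm_sq_eq_ofReal]
  rw [← ENNReal.ofReal_add (by positivity) (by positivity),
    ← ENNReal.ofReal_ofNat 2, ← ENNReal.ofReal_mul (by norm_num)]
  refine ENNReal.ofReal_le_ofReal ?_
  nlinarith [norm_add_le x y, norm_nonneg (x + y), sq_nonneg (‖x‖ - ‖y‖)]

theorem lintegral_enorm_sq_le_of_tendsto {X E : Type*} [TopologicalSpace X]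
    [MeasurableSpace X] [OpensMeasurableSpace X] [HasOuterApproxClosed X]
    [SeminormedAddCommGroup E] {μ : ProbabilityMeasure X} {μs : ℕ → ProbabilityMeasure X}
    (h : Tendsto μs atTop (𝓝 μ)) {g : X → E} (hg : Continuous g) {C : ℝ≥0∞}
    (hC : ∀ n, ∫⁻ x, ‖g x‖ₑ ^ 2 ∂(μs n : Measure X) ≤ C) :
    ∫⁻ x, ‖g x‖ₑ ^ 2 ∂(μ : Measure X) ≤ C := by
  simp only [enorm_sq_eq_ofReal] at hC ⊢
  refine (lintegral_le_liminf_of_tendsto_probabilityMeasure h (f := fun x ↦ ‖g x‖ ^ 2)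
    (by fun_prop) fun x ↦ by positivity).trans ?_
  exact liminf_le_of_le (by isBoundedDefault) fun b hb ↦
    let ⟨n, hn⟩ := hb.exists
    hn.trans (hC n)

/-- Chebyshev: a family of measures with uniformly bounded second moments is tight. -/
theorem isTightMeasureSet_of_lintegral_enorm_sq_le {E : Type*} [NormedAddCommGroup E]
    [ProperSpace E] [MeasurableSpace E] [BorelSpace E] {S : Set (Measure E)} {C : ℝ≥0∞}
    (hC : C ≠ ∞) (hS : ∀ μ ∈ S, ∫⁻ x, ‖x‖ₑ ^ 2 ∂μ ≤ C) : IsTightMeasureSet S := by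
  refine isTightMeasureSet_of_tendsto_measure_norm_gt ?_
  have hlim : Tendsto (fun r : ℝ ↦ C / ENNReal.ofReal (r ^ 2)) atTop (𝓝 0) := by
    have := ENNReal.Tendsto.const_div (a := C)
      (ENNReal.tendsto_ofReal_atTop.comp (tendsto_pow_atTop (α := ℝ) two_ne_zero)) (Or.inr hC)
    simpa using this
  refine tendsto_of_tendsto_of_tendsto_of_le_of_le' tendsto_const_nhds hlim
    (Eventually.of_forall fun _ ↦ zero_le) ?_
  filter_upwards [eventually_gt_atTop 0] with r hr
  refine iSup₂_le fun μ hμ ↦ ?_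
  calc μ {x | r < ‖x‖} ≤ μ {x | ENNReal.ofReal (r ^ 2) ≤ ‖x‖ₑ ^ 2} := by
        refine measure_mono fun x (hx : r < ‖x‖) ↦ ?_
        simp only [Set.mem_ofPred_eq, enorm_sq_eq_ofReal]
        gcongr
    _ ≤ (∫⁻ x, ‖x‖ₑ ^ 2 ∂μ) / ENNReal.ofReal (r ^ 2) :=
        meas_ge_le_lintegral_div (by fun_prop) (by simp [hr.ne']) ENNReal.ofReal_ne_top
    _ ≤ C / ENNReal.ofReal (r ^ 2) := by gcongr; exact hS μ hμ

section Wasserstein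

variable {d : ℕ}

/-- With strict inequalities, no optimal coupling has to exist. -/
theorem W2_lt_iff {μ ν : P2 d} {r : ℝ≥0∞} :
    W2 μ ν < r ↔ ∃ π ∈ couplings μ ν, ∫⁻ z, ‖z.1 - z.2‖ₑ ^ 2
      ∂(π : Measure (EuclideanSpace ℝ (Fin d) × EuclideanSpace ℝ (Fin d))) < r ^ 2 := by
  rw [W2, one_div, ENNReal.rpow_inv_lt_iff two_pos, ENNReal.rpow_ofNat]
  simp only [iInf_lt_iff, exists_prop]

theorem measurable_W2 (μ : P2 d) : Measurable (W2 μ) :=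
  measurable_of_Iio fun r ↦
    have h : IsOpen (W2 μ ⁻¹' Set.Iio r) :=
      TopologicalSpace.isOpen_generateFrom_of_mem ⟨μ, r, rfl⟩
    h.measurableSet

theorem second_moment_le_of_W2_lt {μ ν : P2 d} {r : ℝ≥0∞} (h : W2 μ ν < r) :
    ∫⁻ x, ‖x‖ₑ ^ 2 ∂(μ.prob : Measure (EuclideanSpace ℝ (Fin d))) ≤
      2 * (r ^ 2 + ∫⁻ x, ‖x‖ₑ ^ 2 ∂(ν.prob : Measure (EuclideanSpace ℝ (Fin d)))) := by
  obtain ⟨π, ⟨h1, h2⟩, hπ⟩ := W2_lt_iff.1 h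
  set ρ := (π : Measure (EuclideanSpace ℝ (Fin d) × EuclideanSpace ℝ (Fin d)))
  rw [← h1, ← h2, lintegral_map (by fun_prop) measurable_fst,
    lintegral_map (by fun_prop) measurable_snd]
  calc ∫⁻ z, ‖z.1‖ₑ ^ 2 ∂ρ
      ≤ ∫⁻ z, 2 * (‖z.1 - z.2‖ₑ ^ 2 + ‖z.2‖ₑ ^ 2) ∂ρ := by
        exact lintegral_mono fun z ↦ by simpa using enorm_add_sq_le (z.1 - z.2) z.2
    _ = 2 * (∫⁻ z, ‖z.1 - z.2‖ₑ ^ 2 ∂ρ + ∫⁻ z, ‖z.2‖ₑ ^ 2 ∂ρ) := by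
        rw [lintegral_const_mul _ (by fun_prop), lintegral_add_left (by fun_prop)]
    _ ≤ _ := by gcongr

/-- Couplings of weakly convergent sequences of measures converge weakly along a subsequence. -/
theorem exists_subseq_tendsto_coupling {μs : ℕ → P2 d} {μ ν : P2 d}
    (h : Tendsto (fun n ↦ (μs n).prob) atTop (𝓝 μ.prob))
    {πs : ℕ → ProbabilityMeasure (EuclideanSpace ℝ (Fin d) × EuclideanSpace ℝ (Fin d))}
    (hπs : ∀ n, πs n ∈ couplings (μs n) ν) :
    ∃ π ∈ couplings μ ν, ∃ φ : ℕ → ℕ, StrictMono φ ∧ Tendsto (πs ∘ φ) atTop (𝓝 π) := by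
  have htight : IsTightMeasureSet {(π : Measure (EuclideanSpace ℝ (Fin d) × EuclideanSpace ℝ (Fin d))) |
      π ∈ Set.range πs} := by
    refine IsTightMeasureSet.prodMk ?_ ?_
    -- A convergent sequence together with its limit is compact, hence tight by the converse half of
    -- Prokhorov's theorem.
    · refine (isTightMeasureSet_of_isCompact_closure
        (S := insert μ.prob (Set.range fun n ↦ (μs n).prob)) ?_).subset ?_
      · rw [h.isCompact_insert_range.isClosed.closure_eq]
        exact h.isCompact_insert_range
      · rintro _ ⟨_, ⟨_, ⟨n, rfl⟩, rfl⟩, rfl⟩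
        exact ⟨(μs n).prob, Or.inr ⟨n, rfl⟩, (hπs n).1.symm⟩
    · refine (isTightMeasureSet_singleton
        (μ := (ν.prob : Measure (EuclideanSpace ℝ (Fin d))))).subset ?_
      rintro _ ⟨_, ⟨_, ⟨n, rfl⟩, rfl⟩, rfl⟩
      exact (hπs n).2
  obtain ⟨π, -, φ, hφ, hlim⟩ :=
    (isCompact_closure_of_isTightMeasureSet htight).tendsto_subseq
      fun n ↦ subset_closure (Set.mem_range_self n)
  refine ⟨π, ⟨?_, ?_⟩, φ, hφ, hlim⟩
  · have h1 := ((ProbabilityMeasure.continuous_map continuous_fst).tendsto π).comp hlim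
    have h2 := h.comp hφ.tendsto_atTop
    have h12 := tendsto_nhds_unique h1 (h2.congr fun n ↦ Subtype.ext (hπs (φ n)).1.symm)
    exact congrArg Subtype.val h12
  · have h1 := ((ProbabilityMeasure.continuous_map continuous_snd).tendsto π).comp hlim
    have h12 := tendsto_nhds_unique h1
      ((tendsto_const_nhds (x := ν.prob)).congr fun n ↦ Subtype.ext (hπs (φ n)).2.symm)
    exact congrArg Subtype.val h12

/-- `𝒲₂` is lower semicontinuous for weak convergence of its first argument. -/
theorem W2_le_liminf_of_tendsto {μs : ℕ → P2 d} {μ : P2 d}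
    (h : Tendsto (fun n ↦ (μs n).prob) atTop (𝓝 μ.prob)) (ν : P2 d) :
    W2 μ ν ≤ atTop.liminf fun n ↦ W2 (μs n) ν := by
  by_contra! hlt
  obtain ⟨c, hc, hcW⟩ := exists_between hlt
  obtain ⟨ψ, hψ, hψc⟩ := extraction_of_frequently_atTop
    (frequently_lt_of_liminf_lt (by isBoundedDefault) hc)
  choose πs hπs hcost using fun n ↦ W2_lt_iff.1 (hψc n)
  obtain ⟨π, hπ, φ, -, hlim⟩ :=
    exists_subseq_tendsto_coupling (h.comp hψ.tendsto_atTop) hπs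
  have hle : ∫⁻ z, ‖z.1 - z.2‖ₑ ^ 2 
      ∂(π : Measure (EuclideanSpace ℝ (Fin d) × EuclideanSpace ℝ (Fin d))) ≤ c ^ 2 :=
    lintegral_enorm_sq_le_of_tendsto hlim (g := fun z ↦ z.1 - z.2) (by fun_prop)
      fun n ↦ (hcost (φ n)).le
  -- The limit coupling costs at most `c ^ 2`, possibly with equality; the gap up to `b` restores
  -- strictness.
  obtain ⟨b, hcb, hbW⟩ := exists_between hcW
  have hcb2 : c ^ 2 < b ^ 2 := ENNReal.pow_lt_pow_left two_ne_zero hcb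
  exact (W2_lt_iff.2 ⟨π, hπ, hle.trans_lt hcb2⟩).not_gt hbW

/-- A sublevel set of the Fréchet functional has uniformly bounded second moments. -/
theorem exists_second_moment_le_of_frechetFunctional_le {Ω : Type*} [MeasurableSpace Ω]
    (P : Measure Ω) [IsProbabilityMeasure P] (Λ : Ω → P2 d) (hΛ : Measurable Λ) {C : ℝ≥0∞}
    (hC : C ≠ ∞) :
    ∃ M : ℝ≥0∞, M ≠ ∞ ∧ ∀ ν : P2 d, frechetFunctional P Λ ν ≤ C →
      ∫⁻ x, ‖x‖ₑ ^ 2 ∂(ν.prob : Measure (EuclideanSpace ℝ (Fin d))) ≤ M := by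
  let m : P2 d → ℝ≥0∞ := fun ξ ↦
    ∫⁻ x, ‖x‖ₑ ^ 2 ∂(ξ.prob : Measure (EuclideanSpace ℝ (Fin d)))
  -- These events increase to the whole space, each second moment being finite; continuity from
  -- below needs no measurability of `m`.
  obtain ⟨R, hR⟩ : ∃ R : ℕ, 1 / 2 < P {ω | m (Λ ω) ≤ R} := by
    have hmono : Monotone fun R : ℕ ↦ {ω | m (Λ ω) ≤ R} := fun a b hab ω hω ↦
      le_trans (Set.mem_ofPred_eq ▸ hω) (Nat.cast_le.2 hab)
    have huniv : ⋃ R : ℕ, {ω | m (Λ ω) ≤ R} = Set.univ :=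
      Set.eq_univ_of_forall fun ω ↦ Set.mem_iUnion.2 <|
        let ⟨R, hR⟩ := ENNReal.exists_nat_gt (Λ ω).second_moment_lt_top.ne
        ⟨R, hR.le⟩
    have hlim := tendsto_measure_iUnion_atTop (μ := P) hmono
    rw [huniv, measure_univ] at hlim
    exact (hlim.eventually (lt_mem_nhds (by simp))).exists
  -- `2 * C` makes Markov's bound at most 1/2; the `+ 1` keeps `c` nonzero when `C = 0`.
  let c : ℝ≥0∞ := 2 * C + 1
  have hc : c ≠ ∞ := by finiteness
  refine ⟨2 * (c ^ 2 + R), by finiteness, fun ν hν ↦ ?_⟩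
  have hmarkov : P {ω | c ≤ W2 ν (Λ ω)} ≤ 1 / 2 :=
    calc P {ω | c ≤ W2 ν (Λ ω)} ≤ frechetFunctional P Λ ν / c :=
          meas_ge_le_lintegral_div ((measurable_W2 ν).comp hΛ).aemeasurable (by simp [c]) hc
      _ ≤ 1 / 2 := by
          refine ENNReal.div_le_of_le_mul (hν.trans ?_)
          calc C = 1 / 2 * (2 * C) := by
                rw [← mul_assoc, one_div, ENNReal.inv_mul_cancel two_ne_zero (by simp), one_mul]
            _ ≤ 1 / 2 * c := by gcongr; exact le_self_add
  -- An event of probability above 1/2 cannot lie inside one of probability at most 1/2.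
  obtain ⟨ω, hω, hωc⟩ : ∃ ω, m (Λ ω) ≤ R ∧ W2 ν (Λ ω) < c := by
    by_contra! hcon
    exact (hR.trans_le ((measure_mono hcon).trans hmarkov)).false
  exact (second_moment_le_of_W2_lt hωc).trans (by gcongr)

end Wasserstein

theorem proposition1 (d : ℕ) {Ω : Type*} [MeasurableSpace Ω] (P : Measure Ω)
    [IsProbabilityMeasure P] (Λ : Ω → P2 d) (hΛ : Measurable Λ) :
    ∃ ν : P2 d, IsWassersteinMedian P Λ ν := by
  rcases eq_or_ne (⨅ ν, frechetFunctional P Λ ν) ∞ with htop | htop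
  · obtain ⟨ω⟩ : Nonempty Ω := nonempty_of_isProbabilityMeasure P
    exact ⟨Λ ω, fun ξ ↦ by rw [iInf_eq_top.1 htop ξ]; exact le_top⟩
  -- All `u n` are finite and lie strictly above the infimum, so `u 0` is a finite level bounding
  -- the whole minimizing sequence.
  obtain ⟨u, hu_anti, hu, hu_lim⟩ := exists_seq_strictAnti_tendsto' (lt_top_iff_ne_top.2 htop)
  choose νs hνs using fun n ↦ iInf_lt_iff.1 (hu n).1
  obtain ⟨M, hM, hνsM⟩ :=
    exists_second_moment_le_of_frechetFunctional_le P Λ hΛ (hu 0).2.ne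
  have hmoment n := hνsM (νs n) ((hνs n).le.trans (hu_anti.antitone n.zero_le))
  have htight : IsTightMeasureSet {((π : ProbabilityMeasure (EuclideanSpace ℝ (Fin d))) :
      Measure (EuclideanSpace ℝ (Fin d))) | π ∈ Set.range fun n ↦ (νs n).prob} := by
    refine isTightMeasureSet_of_lintegral_enorm_sq_le hM ?_
    rintro _ ⟨_, ⟨n, rfl⟩, rfl⟩
    exact hmoment n
  obtain ⟨ν, -, φ, hφ, hlim⟩ :=
    (isCompact_closure_of_isTightMeasureSet htight).tendsto_subseq
      fun n ↦ subset_closure (Set.mem_range_self n)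
  let νlim : P2 d := ⟨ν, (lintegral_enorm_sq_le_of_tendsto hlim continuous_id
    fun n ↦ hmoment (φ n)).trans_lt (lt_top_iff_ne_top.2 hM)⟩
  refine ⟨νlim, fun ξ ↦ le_trans ?_ (iInf_le _ ξ)⟩
  calc frechetFunctional P Λ νlim
      ≤ ∫⁻ ω, atTop.liminf (fun n ↦ W2 (νs (φ n)) (Λ ω)) ∂P :=
        lintegral_mono fun ω ↦ W2_le_liminf_of_tendsto (μ := νlim) hlim (Λ ω)
    _ ≤ atTop.liminf fun n ↦ frechetFunctional P Λ (νs (φ n)) :=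
        lintegral_liminf_le fun n ↦ (measurable_W2 _).comp hΛ
    _ ≤ atTop.liminf fun n ↦ u (φ n) :=
        liminf_le_liminf (Eventually.of_forall fun n ↦ (hνs (φ n)).le)
    _ = ⨅ ν, frechetFunctional P Λ ν := (hu_lim.comp hφ.tendsto_atTop).liminf_eq
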